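/- Let $X\subseteq\mathbb{C}^n$ be a complex analytic variety (a closed analytic subset of an open set $\Omega\subseteq\mathbb{C}^n$, with the reduced structure sheaf $\mathcal{O}_X$), let $\mathcal{M}\subseteq\mathcal{O}_X^p$ be an $\mathcal{O}_X$-submodule generated by finitely many global sections, and let $k\ge 1$ be such that $\mathcal{M}$ has generic rank $k$ on each irreducible component of $X$ (that is, on each component $k$ is the largest rank that a matrix of generators of $\mathcal{M}$ attains). Notation. For a submodule $N$ of $R^q$, $R$ a commutative ring, $I_m(N)\subseteq R$ is the ideal generated by the $m\times m$ minors of a matrix of generators of $N$. Let $\pi_1,\pi_2:X\times X\to X$ be the projections. For $x\in X$ and $h\in\mathcal{O}_{X,x}^q$ put $h_D=(h\circ\pi_1,h\circ\pi_2)\in\mathcal{O}_{X\times X,(x,x)}^{2q}$; for a submodule $N\subseteq\mathcal{O}_{X,x}^q$ the double $N_D$ at $(x,x)$ is the $\mathcal{O}_{X\times X,(x,x)}$-submodule of $\mathcal{O}_{X\times X,(x,x)}^{2q}$ generated by all $h_D$, $h\in N$ (for an ideal of $\mathcal{O}_{X,x}$ take $q=1$). Let $I_\Delta\subseteq\mathcal{O}_{X\times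 X,(x,x)}$ be the ideal generated by $z_i\circ\pi_1-z_i\circ\pi_2$, $1\le i\le n$, where $z_1,\dots,z_n$ are the coordinates of $\mathbb{C}^n$. A Zariski open subset is the complement of an analytic subset. Then there is a dense Zariski open subset $U$ of $X$ such that: 1. $U\cap V$ is a dense Zariski open subset of $V$ for every irreducible component $V$ of $X$; 2. $I_k(\mathcal{M}_x)=\mathcal{O}_{X,x}$ for all $x\in U$; 3. $I_{2k}((\mathcal{M}_x)_D)\subseteq I_\Delta^{\,k-1}\, I_2\big((I_k(\mathcal{M}_x))_D\big)$ in $\mathcal{O}_{X\times X,(x,x)}$ for all $x\in U$. -/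

import Mathlib

open Filter Topology

noncomputable section

namespace AnalyticDouble

theorem tendsto_fst_nhdsWithin {E : Type*} [TopologicalSpace E] (X : Set E) (x y : E) :
    Tendsto Prod.fst (𝓝[X ×ˢ X] (x, y)) (𝓝[X] x) :=
  tendsto_nhdsWithin_iff.2
    ⟨continuous_fst.continuousAt.tendsto.mono_left nhdsWithin_le_nhds,
      eventually_nhdsWithin_of_forall fun _ hz => hz.1⟩

theorem tendsto_snd_nhdsWithin {E : Type*} [TopologicalSpace E] (X : Set E) (x y : E) :
    Tendsto Prod.snd (𝓝[X ×ˢ X] (x, y)) (𝓝[X] y) :=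
  tendsto_nhdsWithin_iff.2
    ⟨continuous_snd.continuousAt.tendsto.mono_left nhdsWithin_le_nhds,
      eventually_nhdsWithin_of_forall fun _ hz => hz.2⟩

section LocalRings

variable {E : Type*} [NormedAddCommGroup E] [NormedSpace ℂ E]

/-- The local ring `𝒪_{X,x}` of a (reduced) analytic variety `X`: the germs at `x` of functions
on `X` which are restrictions to `X` of functions analytic on a neighbourhood of `x` in the ambient
space. Two such functions define the same element iff they agree on `X` near `x`, so this is the
ring of ambient analytic germs modulo the germs that vanish on `X`. -/
def localRing (X : Set E) (x : E) : Subring (Germ (𝓝[X] x) ℂ) where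
  carrier := {φ | ∃ F : E → ℂ, AnalyticAt ℂ F x ∧ φ = (F : Germ (𝓝[X] x) ℂ)}
  mul_mem' := by
    rintro _ _ ⟨F, hF, rfl⟩ ⟨G, hG, rfl⟩
    exact ⟨F * G, hF.mul hG, rfl⟩
  one_mem' := ⟨fun _ => 1, analyticAt_const, rfl⟩
  add_mem' := by
    rintro _ _ ⟨F, hF, rfl⟩ ⟨G, hG, rfl⟩
    exact ⟨F + G, hF.add hG, rfl⟩
  zero_mem' := ⟨fun _ => 0, analyticAt_const, rfl⟩
  neg_mem' := by
    rintro _ ⟨F, hF, rfl⟩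
    exact ⟨-F, hF.neg, rfl⟩

/-- A complex function is holomorphic on the variety `X` (a global section of `𝒪_X`) if at each
point of `X` it agrees on `X` with an ambient analytic function. -/
def IsHolomorphicOn (X : Set E) (f : E → ℂ) : Prop :=
  ∀ x ∈ X, (f : Germ (𝓝[X] x) ℂ) ∈ localRing X x

/-- The germ at `x ∈ X` of a function holomorphic on `X`. -/
def germAt {X : Set E} {f : E → ℂ} (hf : IsHolomorphicOn X f) (x : X) : localRing X (x : E) :=
  ⟨(f : Germ (𝓝[X] (x : E)) ℂ), hf x x.2⟩

/-- The value at `x ∈ X` of a germ in `𝒪_{X,x}`. -/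
def evalGerm {X : Set E} (x : X) (φ : localRing X (x : E)) : ℂ :=
  Germ.liftOn (φ : Germ (𝓝[X] (x : E)) ℂ) (fun f => f x)
    (fun _ _ h => h.eq_of_nhdsWithin x.2)

/-- Pullback of germs along the first projection, `h ↦ h ∘ π₁`,
from `𝒪_{X,x}` to `𝒪_{X×X,(x,y)}`. -/
def pullFst (X : Set E) (x y : E) : localRing X x →+* localRing (X ×ˢ X) (x, y) where
  toFun φ := ⟨(φ : Germ (𝓝[X] x) ℂ).compTendsto Prod.fst (tendsto_fst_nhdsWithin X x y), by
    obtain ⟨_, F, hF, rfl⟩ := φ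
    exact ⟨F ∘ Prod.fst, AnalyticAt.comp (x := (x, y)) hF analyticAt_fst, rfl⟩⟩
  map_one' := rfl
  map_zero' := rfl
  map_mul' := by
    rintro ⟨_, F, hF, rfl⟩ ⟨_, G, hG, rfl⟩
    rfl
  map_add' := by
    rintro ⟨_, F, hF, rfl⟩ ⟨_, G, hG, rfl⟩
    rfl

/-- Pullback of germs along the second projection, `h ↦ h ∘ π₂`,
from `𝒪_{X,y}` to `𝒪_{X×X,(x,y)}`. -/
def pullSnd (X : Set E) (x y : E) : localRing X y →+* localRing (X ×ˢ X) (x, y) where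
  toFun φ := ⟨(φ : Germ (𝓝[X] y) ℂ).compTendsto Prod.snd (tendsto_snd_nhdsWithin X x y), by
    obtain ⟨_, F, hF, rfl⟩ := φ
    exact ⟨F ∘ Prod.snd, AnalyticAt.comp (x := (x, y)) hF analyticAt_snd, rfl⟩⟩
  map_one' := rfl
  map_zero' := rfl
  map_mul' := by
    rintro ⟨_, F, hF, rfl⟩ ⟨_, G, hG, rfl⟩
    rfl
  map_add' := by
    rintro ⟨_, F, hF, rfl⟩ ⟨_, G, hG, rfl⟩
    rfl

end LocalRings

section AnalyticSets

variable {E : Type*} [NormedAddCommGroup E] [NormedSpace ℂ E]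

/-- `A` is an analytic subset of `Y`: near every point of `Y`, it is the common zero set in `Y`
of finitely many (ambient) analytic functions. For `Y` open in `ℂⁿ` this is the usual notion of
a closed analytic subset of a domain; for `Y` itself analytic it is that of an analytic subset
of the variety `Y`. -/
def IsAnalyticSubset (Y A : Set E) : Prop :=
  A ⊆ Y ∧ ∀ x ∈ Y, ∃ W : Set E, IsOpen W ∧ x ∈ W ∧ ∃ (m : ℕ) (f : Fin m → E → ℂ),
    (∀ j, AnalyticOnNhd ℂ (f j) W) ∧ A ∩ W = {y | y ∈ Y ∩ W ∧ ∀ j, f j y = 0}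

/-- `S` is a Zariski open subset of `Y`: the complement in `Y` of an analytic subset of `Y`. -/
def IsZariskiOpenIn (Y S : Set E) : Prop :=
  S ⊆ Y ∧ IsAnalyticSubset Y (Y \ S)

/-- `S` is a Zariski open subset of `Y` which is dense in `Y`. -/
def IsDenseZariskiOpenIn (Y S : Set E) : Prop :=
  IsZariskiOpenIn Y S ∧ Y ⊆ closure S

/-- The regular points of `X`: the points of `X` near which a biholomorphic change of the ambient
coordinates carries `X` to a linear subspace, i.e. near which `X` is a complex submanifold. -/
def regularLocus (X : Set E) : Set E :=
  {x | x ∈ X ∧ ∃ (e : OpenPartialHomeomorph E E) (L : Submodule ℂ E), x ∈ e.source ∧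
    AnalyticOnNhd ℂ e e.source ∧ AnalyticOnNhd ℂ e.symm e.target ∧
    ∀ y ∈ e.source, (y ∈ X ↔ e y ∈ L)}

/-- The irreducible components of an analytic variety `X`: the closures in `X` of the connected
components of the manifold of regular points of `X`. -/
def IsComponent (X V : Set E) : Prop :=
  ∃ x ∈ regularLocus X, V = X ∩ closure (connectedComponentIn (regularLocus X) x)

end AnalyticSets

section Minors

variable {R : Type*} [CommRing R] {ι : Type*}

/-- The ideal `I_k(N)` of a submodule `N` of the free module `R^ι`: it is generated by the `k × k`
minors of the matrices whose columns lie in `N`. By `minorIdeal_span` below, this is the ideal of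
`k × k` minors of any matrix of generators of `N`. -/
def minorIdeal (k : ℕ) (N : Submodule R (ι → R)) : Ideal R :=
  Ideal.span {d | ∃ (rows : Fin k → ι) (cols : Fin k → ι → R), (∀ j, cols j ∈ N) ∧
    d = Matrix.det (Matrix.of fun i j => cols j (rows i))}

/-- `I_k` of a submodule is the ideal of `k × k` minors of any matrix of generators. -/
theorem minorIdeal_span {κ : Type*} (k : ℕ) (g : κ → ι → R) :
    minorIdeal k (Submodule.span R (Set.range g)) =
      Ideal.span {d | ∃ (rows : Fin k → ι) (cols : Fin k → κ),
        d = Matrix.det (Matrix.of fun i j => g (cols j) (rows i))} := by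
  classical
  apply le_antisymm
  · refine Ideal.span_le.2 ?_
    rintro _ ⟨rows, c, hc, rfl⟩
    set J : Ideal R := Ideal.span {d | ∃ (rows : Fin k → ι) (cols : Fin k → κ),
        d = Matrix.det (Matrix.of fun i j => g (cols j) (rows i))} with hJ
    let D : MultilinearMap R (fun _ : Fin k => ι → R) R :=
      (Matrix.detRowAlternating (R := R) (n := Fin k)).toMultilinearMap.compLinearMap
        (fun _ => LinearMap.funLeft R R rows)
    have hD : ∀ c : Fin k → ι → R, D c = Matrix.det (Matrix.of fun i j => c j (rows i)) := by
      intro c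
      rw [← Matrix.det_transpose]
      rfl
    have key : ∀ (t : Finset (Fin k)) (c : Fin k → ι → R),
        (∀ j ∈ t, c j ∈ Submodule.span R (Set.range g)) → (∀ j, j ∉ t → c j ∈ Set.range g) →
        D c ∈ J := by
      intro t
      induction t using Finset.induction_on with
      | empty =>
        intro c _ h
        choose f hf using fun j => h j (Finset.notMem_empty j)
        refine Ideal.subset_span ⟨rows, f, ?_⟩
        rw [hD]
        simp only [hf]
      | insert a t ha ih =>
        intro c h1 h2
        have hu : ∀ v ∈ Submodule.span R (Set.range g), D (Function.update c a v) ∈ J := by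
          intro v hv
          induction hv using Submodule.span_induction with
          | mem v hv =>
            refine ih _ ?_ ?_
            · intro j hj
              have hja : j ≠ a := fun h => ha (h ▸ hj)
              rw [Function.update_of_ne hja]
              exact h1 j (Finset.mem_insert_of_mem hj)
            · intro j hj
              by_cases hja : j = a
              · subst hja
                simpa using hv
              · rw [Function.update_of_ne hja]
                exact h2 j (by simp [hja, hj])
          | zero => rw [D.map_update_zero]; exact J.zero_mem
          | add v w _ _ hv hw => rw [D.map_update_add]; exact J.add_mem hv hw
          | smul r v _ hv => rw [D.map_update_smul]; exact J.mul_mem_left r hv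
        have := hu (c a) (h1 a (Finset.mem_insert_self a t))
        rwa [Function.update_eq_self] at this
    have := key Finset.univ c (fun j _ => hc j) (fun j hj => absurd (Finset.mem_univ j) hj)
    rwa [hD] at this
  · refine Ideal.span_le.2 ?_
    rintro _ ⟨rows, cols, rfl⟩
    exact Ideal.subset_span
      ⟨rows, fun j => g (cols j), fun j => Submodule.subset_span ⟨cols j, rfl⟩, rfl⟩

end Minors

section Doubles

variable {n p : ℕ}

/-- The double `h_D = (h ∘ π₁, h ∘ π₂) ∈ 𝒪_{X×X,(x,x)}^{2p}` of `h ∈ 𝒪_{X,x}^p`. -/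
def double (X : Set (Fin n → ℂ)) (x : Fin n → ℂ) (h : Fin p → localRing X x) :
    Fin p ⊕ Fin p → localRing (X ×ˢ X) (x, x) :=
  Sum.elim (fun i => pullFst X x x (h i)) (fun i => pullSnd X x x (h i))

/-- The double `N_D` at `(x,x)` of a submodule `N` of `𝒪_{X,x}^p`. -/
def doubleModule (X : Set (Fin n → ℂ)) (x : Fin n → ℂ)
    (N : Submodule (localRing X x) (Fin p → localRing X x)) :
    Submodule (localRing (X ×ˢ X) (x, x)) (Fin p ⊕ Fin p → localRing (X ×ˢ X) (x, x)) :=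
  Submodule.span _ (double X x '' (N : Set (Fin p → localRing X x)))

/-- The double `I_D ⊆ 𝒪_{X×X,(x,x)}^2` at `(x,x)` of an ideal `I` of `𝒪_{X,x}`. -/
def doubleIdeal (X : Set (Fin n → ℂ)) (x : Fin n → ℂ) (I : Ideal (localRing X x)) :
    Submodule (localRing (X ×ˢ X) (x, x)) (Fin 2 → localRing (X ×ˢ X) (x, x)) :=
  Submodule.span _ ((fun h => ![pullFst X x x h, pullSnd X x x h]) '' (I : Set (localRing X x)))

/-- The germ at `x` of the `i`-th coordinate function `z_i` on `X ⊆ ℂⁿ`. -/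
def coordGerm (X : Set (Fin n → ℂ)) (x : Fin n → ℂ) (i : Fin n) : localRing X x :=
  ⟨((fun z => z i : (Fin n → ℂ) → ℂ) : Germ (𝓝[X] x) ℂ), fun z => z i,
    (ContinuousLinearMap.proj (R := ℂ) (φ := fun _ : Fin n => ℂ) i).analyticAt x, rfl⟩

/-- The ideal `I_Δ` of the diagonal in `𝒪_{X×X,(x,x)}`, generated by the germs
`z_i ∘ π₁ - z_i ∘ π₂`. -/
def diagonalIdeal (X : Set (Fin n → ℂ)) (x : Fin n → ℂ) : Ideal (localRing (X ×ˢ X) (x, x)) :=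
  Ideal.span (Set.range fun i =>
    pullFst X x x (coordGerm X x i) - pullSnd X x x (coordGerm X x i))

/-- A family of stalks `M_x ⊆ 𝒪_{X,x}^p` is the `𝒪_X`-submodule of `𝒪_X^p` generated by finitely
many global sections `s_1, …, s_r ∈ 𝒪_X(X)^p`. (A subsheaf is determined by its stalks.) -/
def IsGloballyGenerated (X : Set (Fin n → ℂ))
    (M : ∀ x : X, Submodule (localRing X (x : Fin n → ℂ)) (Fin p → localRing X (x : Fin n → ℂ))) :
    Prop :=
  ∃ (r : ℕ) (s : Fin r → Fin p → (Fin n → ℂ) → ℂ) (hs : ∀ j i, IsHolomorphicOn X (s j i)),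
    ∀ x : X, M x = Submodule.span _ (Set.range fun j => fun i => germAt (hs j i) x)

/-- The rank at `x` of a submodule `N` of `𝒪_{X,x}^p`: the dimension of its space of values in
`ℂ^p`, i.e. the rank at `x` of a matrix of generators. -/
def rankAt {X : Set (Fin n → ℂ)} (x : X)
    (N : Submodule (localRing X (x : Fin n → ℂ)) (Fin p → localRing X (x : Fin n → ℂ))) : ℕ :=
  Module.finrank ℂ (Submodule.span ℂ ((fun h : Fin p → localRing X (x : Fin n → ℂ) =>
    fun i => evalGerm x (h i)) '' (N : Set (Fin p → localRing X (x : Fin n → ℂ)))))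

/-- `M` has generic rank `k` on the component `V` of `X`: `k` is the largest rank that a matrix of
generators of `M` attains at points of `V`, i.e. some `k × k` minor does not vanish identically
on `V`, and all larger minors do. -/
def HasGenericRank (X : Set (Fin n → ℂ))
    (M : ∀ x : X, Submodule (localRing X (x : Fin n → ℂ)) (Fin p → localRing X (x : Fin n → ℂ)))
    (V : Set (Fin n → ℂ)) (k : ℕ) : Prop :=
  IsGreatest {m | ∃ x : X, (x : Fin n → ℂ) ∈ V ∧ rankAt x (M x) = m} k

end Doubles

end AnalyticDouble

end

open AnalyticDouble

/-!
The open set `U` is the set of points of `X` at which some `k × k` minor of a matrix of generators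
of `M` is nonzero.

*Density.* Near a suitable point of `X`, arbitrarily close to a given one, take as many analytic
functions vanishing on `X` with independent differentials as possible. Their common zero set `Z` is
a submanifold containing `X`, and by maximality the derivatives along `Z` of a function vanishing on
`X` vanish on `X` again. Hence the Taylor series on `Z` of the local equations of `X` are zero, so
that `X = Z` near that point, which is thus regular: the regular points are dense in `X`
(`IsAnalyticSubset.subset_closure_regularLocus`). On a connected component of the regular locus the
identity theorem holds (`IsHolomorphicOn.subset_closure_ne_zero`), so a `k × k` minor that is nonzero
at a point of an irreducible component is nonzero on a dense subset of that component. The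
`(k + 1) × (k + 1)` minors vanish at the regular points, hence on all of `X`.

*The inclusion.* At `x ∈ U` some `k × k` minor is a unit in `𝒪_{X,x}`, so `I_k(M_x)` is the unit
ideal, and as the larger minors vanish, all coordinates of an element of `M_x` are fixed linear
combinations of the `k` coordinates in that minor (`exists_coeff_of_isUnit_det`). Every
`2k × 2k` minor of the double is therefore a multiple of a `2k × 2k` determinant whose upper half is
congruent to its lower half modulo `I_Δ`, by Hadamard's lemma (`AnalyticAt.exists_sub_eq_sum`).
Subtracting the halves shows that it lies in `I_Δ ^ k` (`minorIdeal_doubleModule_le_pow`). Finally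
`I_Δ ⊆ I_2((𝒪_{X,x})_D)`, since `zᵢ ∘ π₂ - zᵢ ∘ π₁` is the determinant of the doubles of `1` and
`zᵢ`.
-/

/-! ### Difference quotients of analytic functions -/

section DifferenceQuotient

variable {E F : Type*} [NormedAddCommGroup E] [NormedSpace ℂ E]
  [NormedAddCommGroup F] [NormedSpace ℂ F]

/-- The power series in `(a, b)` obtained from the difference `p(a) - p(b)` of values of a power
series `p` by telescoping each homogeneous term,
`pₘ₊₁(a, …, a) - pₘ₊₁(b, …, b) = ∑ⱼ pₘ₊₁(a, …, a, a - b, b, …, b)`,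
and replacing the factor `a - b` in position `j` by the fixed vector `e`. -/
noncomputable def differenceSeries (p : FormalMultilinearSeries ℂ E F) (e : E) :
    FormalMultilinearSeries ℂ (E × E) F := fun m =>
  ∑ j : Fin (m + 1), ((p (m + 1)).curryMid j e).compContinuousLinearMap
    (fun i => if i.castSucc < j then ContinuousLinearMap.fst ℂ E E
      else ContinuousLinearMap.snd ℂ E E)

theorem differenceSeries_apply (p : FormalMultilinearSeries ℂ E F) (e : E) (m : ℕ) (a b : E) :
    differenceSeries p e m (fun _ => (a, b)) =
      ∑ j : Fin (m + 1), p (m + 1) (j.insertNth e fun i => if i.castSucc < j then a else b) := by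
  simp only [differenceSeries, _root_.sum_apply,
    ContinuousMultilinearMap.compContinuousLinearMap_apply,
    ContinuousMultilinearMap.curryMid_apply]
  refine Finset.sum_congr rfl fun j _ => ?_
  congr 2
  funext i
  split_ifs <;> rfl

theorem differenceSeries_telescope (p : FormalMultilinearSeries ℂ E F) (m : ℕ) (a b : E) :
    differenceSeries p (a - b) m (fun _ => (a, b)) =
      p (m + 1) (fun _ => a) - p (m + 1) (fun _ => b) := by
  have h := (p (m + 1)).toMultilinearMap.map_piecewise_sub_map_piecewise
    (fun _ => a) (fun _ => b) (fun _ => 0) Finset.univ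
  simp only [Finset.piecewise_univ, Finset.mem_univ, if_true] at h
  rw [differenceSeries_apply]
  refine Eq.trans ?_ h.symm
  refine Finset.sum_congr rfl fun j _ => ?_
  change p (m + 1) _ = p (m + 1) _
  congr 1
  funext i
  refine Fin.succAboveCases j ?_ (fun k => ?_) i
  · simp
  · have h1 : j.succAbove k ≠ j := Fin.succAbove_ne j k
    simp [Fin.succAbove_lt_iff_castSucc_lt]

theorem differenceSeries_sum {n : ℕ} (p : FormalMultilinearSeries ℂ (Fin n → ℂ) F)
    (c : Fin n → ℂ) (m : ℕ) (v : Fin m → (Fin n → ℂ) × (Fin n → ℂ)) :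
    differenceSeries p c m v = ∑ i, c i • differenceSeries p (Pi.single i 1) m v := by
  conv_lhs => rw [← Finset.univ_sum_single c]
  simp only [differenceSeries, _root_.sum_apply,
    ContinuousMultilinearMap.compContinuousLinearMap_apply, map_sum, Finset.smul_sum]
  rw [Finset.sum_comm]
  refine Finset.sum_congr rfl fun i _ => Finset.sum_congr rfl fun j _ => ?_
  have : (Pi.single i (c i) : Fin n → ℂ) = c i • Pi.single i 1 := by
    rw [← Pi.single_smul]; simp
  rw [this, map_smul]
  rfl

theorem norm_differenceSeries_le (p : FormalMultilinearSeries ℂ E F) (e : E) (m : ℕ) :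
    ‖differenceSeries p e m‖ ≤ (m + 1) * (‖p (m + 1)‖ * ‖e‖) := by
  refine (norm_sum_le _ _).trans ?_
  have : ∀ j ∈ (Finset.univ : Finset (Fin (m + 1))),
      ‖((p (m + 1)).curryMid j e).compContinuousLinearMap
        (fun i => if i.castSucc < j then ContinuousLinearMap.fst ℂ E E
          else ContinuousLinearMap.snd ℂ E E)‖ ≤ ‖p (m + 1)‖ * ‖e‖ := by
    intro j _
    refine (ContinuousMultilinearMap.norm_compContinuousLinearMap_le _ _).trans ?_
    have h1 : ‖(p (m + 1)).curryMid j e‖ ≤ ‖p (m + 1)‖ * ‖e‖ := by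
      refine (ContinuousLinearMap.le_opNorm _ _).trans ?_
      rw [ContinuousMultilinearMap.norm_curryMid]
    refine (mul_le_of_le_one_right (norm_nonneg _) ?_).trans h1
    refine Finset.prod_le_one (fun _ _ => norm_nonneg _) fun i _ => ?_
    split_ifs
    · exact ContinuousLinearMap.norm_fst_le ℂ E E
    · exact ContinuousLinearMap.norm_snd_le ℂ E E
  refine (Finset.sum_le_sum this).trans ?_
  simp

theorem differenceSeries_radius_pos (p : FormalMultilinearSeries ℂ E F) (e : E)
    (hp : 0 < p.radius) : 0 < (differenceSeries p e).radius := by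
  obtain ⟨C, r, hC, hr, h⟩ := p.le_mul_pow_of_radius_pos hp
  -- The factor `2⁻¹` absorbs the number `m + 1 ≤ 2 ^ m` of telescoping terms.
  let s : NNReal := ⟨(2 * r)⁻¹, by positivity⟩
  have hs : (0 : NNReal) < s := by
    change (0 : ℝ) < (2 * r)⁻¹
    positivity
  refine lt_of_lt_of_le (ENNReal.coe_pos.2 hs)
    ((differenceSeries p e).le_radius_of_bound (C * r * ‖e‖) fun m => ?_)
  have h2 : ((m : ℝ) + 1) ≤ 2 ^ m := by exact_mod_cast Nat.succ_le_of_lt (Nat.lt_two_pow_self)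
  calc ‖differenceSeries p e m‖ * (s : ℝ) ^ m
      ≤ ((m + 1) * (‖p (m + 1)‖ * ‖e‖)) * ((2 * r)⁻¹) ^ m := by
        gcongr
        · exact norm_differenceSeries_le p e m
        · exact le_rfl
    _ ≤ (2 ^ m * ((C * r ^ (m + 1)) * ‖e‖)) * ((2 * r)⁻¹) ^ m := by
        gcongr
        exact h _
    _ = C * r * ‖e‖ := by
        rw [mul_inv, mul_pow, inv_pow, inv_pow]
        field_simp
        ring

/-- Hadamard's lemma for analytic functions: near a point of the diagonal, `f z - f w` is a
combination of the `zᵢ - wᵢ` with analytic coefficients. -/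
theorem AnalyticAt.exists_sub_eq_sum {n : ℕ} {f : (Fin n → ℂ) → ℂ} {x : Fin n → ℂ}
    (hf : AnalyticAt ℂ f x) :
    ∃ G : Fin n → (Fin n → ℂ) × (Fin n → ℂ) → ℂ, (∀ i, AnalyticAt ℂ (G i) (x, x)) ∧
      ∀ᶠ q in 𝓝 (x, x), f q.1 - f q.2 = ∑ i, (q.1 i - q.2 i) * G i q := by
  obtain ⟨p, r, hp⟩ := hf
  have hrad : 0 < p.radius := hp.r_pos.trans_le hp.r_le
  set P := fun i => differenceSeries p (Pi.single i (1 : ℂ)) with hP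
  have hPr : ∀ i, 0 < (P i).radius := fun i => differenceSeries_radius_pos p _ hrad
  refine ⟨fun i q => (P i).sum (q - (x, x)), fun i => ?_, ?_⟩
  · have h0 : AnalyticAt ℂ (P i).sum ((x, x) - (x, x)) := by
      rw [sub_self]; exact ((P i).hasFPowerSeriesOnBall (hPr i)).analyticAt
    exact AnalyticAt.fun_comp h0 (by fun_prop)
  · have e1 : ∀ᶠ q : (Fin n → ℂ) × (Fin n → ℂ) in 𝓝 (x, x), q.1 ∈ Metric.eball x r :=
      continuous_fst.continuousAt.eventually (Metric.eball_mem_nhds x hp.r_pos)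
    have e2 : ∀ᶠ q : (Fin n → ℂ) × (Fin n → ℂ) in 𝓝 (x, x), q.2 ∈ Metric.eball x r :=
      continuous_snd.continuousAt.eventually (Metric.eball_mem_nhds x hp.r_pos)
    have e3 : ∀ᶠ q : (Fin n → ℂ) × (Fin n → ℂ) in 𝓝 (x, x),
        ∀ i, q - (x, x) ∈ Metric.eball 0 (P i).radius := by
      refine eventually_all.2 fun i => ?_
      have hc : ContinuousAt (fun q : (Fin n → ℂ) × (Fin n → ℂ) => q - (x, x)) (x, x) := by
        fun_prop
      refine hc.eventually ?_
      simp only [sub_self]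
      exact Metric.eball_mem_nhds 0 (hPr i)
    filter_upwards [e1, e2, e3] with q h1 h2 h3
    have s1 := hp.hasSum_sub h1
    have s2 := hp.hasSum_sub h2
    have s3 := s1.sub s2
    rw [← hasSum_nat_add_iff' 1] at s3
    have hz : (p 0 fun _ => q.1 - x) = p 0 fun _ => q.2 - x := by
      congr 1; funext i; exact i.elim0
    simp only [Finset.sum_range_one, hz, sub_self, sub_zero] at s3
    have s4 : HasSum (fun m => ∑ i, (q.1 i - q.2 i) * P i m (fun _ => q - (x, x)))
        (∑ i, (q.1 i - q.2 i) * (P i).sum (q - (x, x))) :=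
      hasSum_sum fun i _ => ((P i).hasSum (h3 i)).mul_left _
    have hterm : (fun m => (p (m + 1) fun _ => q.1 - x) - p (m + 1) fun _ => q.2 - x) =
        fun m => ∑ i, (q.1 i - q.2 i) * P i m (fun _ => q - (x, x)) := by
      funext m
      rw [← differenceSeries_telescope p m, sub_sub_sub_cancel_right, differenceSeries_sum]
      rfl
    rw [hterm] at s3
    exact s3.unique s4

end DifferenceQuotient

/-! ### Regular points are dense -/

namespace AnalyticDouble

section RegularPoints

variable {E : Type*} [NormedAddCommGroup E] [NormedSpace ℂ E]

/-- A local homeomorphism of a Banach space that is analytic with everywhere invertible derivative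
has an analytic inverse. -/
theorem analyticOnNhd_symm_of_isInvertible (e : OpenPartialHomeomorph E E)
    (he : AnalyticOnNhd ℂ e e.source)
    (hinv : ∀ y ∈ e.source, ∃ i : E ≃L[ℂ] E, fderiv ℂ e y = i) :
    AnalyticOnNhd ℂ e.symm e.target := by
  intro z hz
  have hy := e.map_target hz
  obtain ⟨p, hp⟩ := he _ hy
  obtain ⟨i, hi⟩ := hinv _ hy
  have h1 : p 1 = (continuousMultilinearCurryFin1 ℂ E E).symm i := by
    rw [← hi, hp.fderiv_eq, LinearIsometryEquiv.symm_apply_apply]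
  have := (e.hasFPowerSeriesAt_symm hy hp h1).analyticAt
  rwa [e.right_inv hz] at this

/-- A submersion `G` becomes linear in suitable analytic coordinates `e`. If `s` is a linear right
inverse of `A = G'(a)`, then `e y = y + s (G y - A y)` satisfies `A ∘ e = G` and `e'(a) = id`. -/
theorem exists_chart_of_surjective_fderiv [FiniteDimensional ℂ E] {r : ℕ} {U : Set E}
    (hU : IsOpen U) {G : E → Fin r → ℂ} (hG : AnalyticOnNhd ℂ G U) {a : E} (ha : a ∈ U)
    (hsurj : Function.Surjective (fderiv ℂ G a)) :
    ∃ e : OpenPartialHomeomorph E E, a ∈ e.source ∧ e.source ⊆ U ∧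
      AnalyticOnNhd ℂ e e.source ∧ AnalyticOnNhd ℂ e.symm e.target ∧
      ∀ y ∈ e.source, fderiv ℂ G a (e y) = G y := by
  have : CompleteSpace E := FiniteDimensional.complete ℂ E
  set A := fderiv ℂ G a with hA
  obtain ⟨s₀, hs₀⟩ := (A : E →ₗ[ℂ] Fin r → ℂ).exists_rightInverse_of_surjective
    (LinearMap.range_eq_top.2 hsurj)
  let s : (Fin r → ℂ) →L[ℂ] E := LinearMap.toContinuousLinearMap s₀
  have hs : ∀ v, A (s v) = v := fun v => LinearMap.congr_fun hs₀ v
  let φ : E → E := fun y => y + s (G y - A y)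
  have hφ : AnalyticOnNhd ℂ φ U := fun y hy =>
    analyticAt_id.add ((s.analyticAt _).comp ((hG y hy).sub (A.analyticAt y)))
  have hAφ : ∀ y, A (φ y) = G y := fun y => by simp [φ, hs]
  have hφ' : HasStrictFDerivAt φ ((ContinuousLinearEquiv.refl ℂ E : E ≃L[ℂ] E) : E →L[ℂ] E) a := by
    have h1 : HasStrictFDerivAt G A a := (hG a ha).hasStrictFDerivAt
    have h2 := (hasStrictFDerivAt_id (𝕜 := ℂ) a).add
      (s.hasStrictFDerivAt.comp a (h1.sub A.hasStrictFDerivAt))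
    have h3 : ((ContinuousLinearEquiv.refl ℂ E : E ≃L[ℂ] E) : E →L[ℂ] E) =
        ContinuousLinearMap.id ℂ E + s.comp (A - A) := by
      rw [sub_self, ContinuousLinearMap.comp_zero, add_zero]; rfl
    rw [h3]
    exact h2
  let e₀ := hφ'.toOpenPartialHomeomorph φ
  have hinv : ∀ᶠ y in 𝓝 a, ∃ i : E ≃L[ℂ] E, fderiv ℂ φ y = i := by
    have hc : ContinuousAt (fderiv ℂ φ) a := (hφ a ha).fderiv.continuousAt
    have h3 : Set.range ((↑) : (E ≃L[ℂ] E) → E →L[ℂ] E) ∈ 𝓝 (fderiv ℂ φ a) := by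
      rw [hφ'.hasFDerivAt.fderiv]
      exact ContinuousLinearEquiv.nhds _
    filter_upwards [hc h3] with y hy
    obtain ⟨i, hi⟩ := hy
    exact ⟨i, hi.symm⟩
  obtain ⟨O, hO, hOo, haO⟩ := eventually_nhds_iff.1 hinv
  let e := e₀.restrOpen (O ∩ U) (hOo.inter hU)
  have hsrc : e.source = e₀.source ∩ (O ∩ U) := rfl
  have hcoe' : (e : E → E) = φ := rfl
  have han : AnalyticOnNhd ℂ e e.source := fun y hy => hφ y (hsrc ▸ hy).2.2
  refine ⟨e, ?_, fun y hy => (hsrc ▸ hy).2.2, han, ?_, fun y _ => hAφ y⟩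
  · rw [hsrc]
    exact ⟨hφ'.mem_toOpenPartialHomeomorph_source, haO, ha⟩
  · refine analyticOnNhd_symm_of_isInvertible e han fun y hy => ?_
    rw [hcoe']
    exact hO y (hsrc ▸ hy).2.1

theorem analyticOnNhd_iterate_fderiv_apply [CompleteSpace E] {h : E → ℂ} {s : Set E}
    (hh : AnalyticOnNhd ℂ h s) (v : E) (m : ℕ) :
    AnalyticOnNhd ℂ ((fun (f : E → ℂ) y => fderiv ℂ f y v)^[m] h) s := by
  induction m with
  | zero => exact hh
  | succ m ih =>
    rw [Function.iterate_succ_apply']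
    exact fun y hy => (ContinuousLinearMap.apply ℂ ℂ v).analyticAt _ |>.comp (ih y hy).fderiv

/-- An analytic function on a ball whose iterated derivatives in the direction `v` all vanish at
the centre `c` vanishes at `c + v`. -/
theorem eq_zero_of_iterate_fderiv_apply_eq_zero [CompleteSpace E] {h : E → ℂ} {c v : E} {R : ℝ}
    (hh : AnalyticOnNhd ℂ h (Metric.ball c R)) (hv : ‖v‖ < R)
    (h0 : ∀ m, (fun (f : E → ℂ) y => fderiv ℂ f y v)^[m] h c = 0) : h (c + v) = 0 := by
  have hR : 0 < R := (norm_nonneg v).trans_lt hv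
  obtain ⟨ρ, hρ1, hρ⟩ : ∃ ρ : ℝ, 1 < ρ ∧ ρ * ‖v‖ < R := by
    have hc : ContinuousAt (fun ρ : ℝ => ρ * ‖v‖) 1 := by fun_prop
    have h1 : ∀ᶠ ρ in 𝓝[>] (1 : ℝ), ρ * ‖v‖ < R :=
      (hc.eventually_lt continuousAt_const (by simpa using hv)).filter_mono nhdsWithin_le_nhds
    obtain ⟨ρ, h2, h3⟩ := (h1.and self_mem_nhdsWithin).exists
    exact ⟨ρ, h3, h2⟩
  have hmem : ∀ t ∈ Metric.ball (0 : ℂ) ρ, c + t • v ∈ Metric.ball c R := by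
    intro t ht
    rw [mem_ball_zero_iff] at ht
    rw [mem_ball_iff_norm, add_sub_cancel_left, norm_smul]
    exact (mul_le_mul_of_nonneg_right ht.le (norm_nonneg v)).trans_lt hρ
  have hline : ∀ t : ℂ, HasDerivAt (fun t : ℂ => c + t • v) v t := fun t => by
    simpa using ((hasDerivAt_id t).smul_const v).const_add c
  have hder : ∀ m, ∀ t ∈ Metric.ball (0 : ℂ) ρ,
      HasDerivAt (fun t : ℂ => (fun (f : E → ℂ) y => fderiv ℂ f y v)^[m] h (c + t • v))
        ((fun (f : E → ℂ) y => fderiv ℂ f y v)^[m + 1] h (c + t • v)) t := by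
    intro m t ht
    rw [Function.iterate_succ_apply']
    exact ((analyticOnNhd_iterate_fderiv_apply hh v m _
      (hmem t ht)).differentiableAt.hasFDerivAt.comp_hasDerivAt t (hline t))
  have hiter : ∀ m, ∀ t ∈ Metric.ball (0 : ℂ) ρ, iteratedDeriv m (fun t : ℂ => h (c + t • v)) t =
      (fun (f : E → ℂ) y => fderiv ℂ f y v)^[m] h (c + t • v) := by
    intro m
    induction m with
    | zero => intro t _; simp
    | succ m ih =>
      intro t ht
      rw [iteratedDeriv_succ, ← (hder m t ht).deriv]
      refine Filter.EventuallyEq.deriv_eq ?_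
      filter_upwards [Metric.isOpen_ball.mem_nhds ht] with u hu using ih u hu
  have hmain := Complex.taylorSeries_eq_on_ball' (c := 0) (r := ρ) (z := 1)
    (f := fun t : ℂ => h (c + t • v)) (by simpa using hρ1)
    (fun t ht => (hder 0 t ht).differentiableAt.differentiableWithinAt)
  have hz : ∀ m, iteratedDeriv m (fun t : ℂ => h (c + t • v)) 0 = 0 := fun m => by
    rw [hiter m 0 (Metric.mem_ball_self (by linarith))]
    simpa using h0 m
  simpa [hz] using hmain.symm

/-- The regular points of an analytic subset of a domain are dense in it. -/
theorem IsAnalyticSubset.subset_closure_regularLocus [FiniteDimensional ℂ E] {Ω X : Set E}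
    (hΩ : IsOpen Ω) (hX : IsAnalyticSubset Ω X) : X ⊆ closure (regularLocus X) := by
  have : CompleteSpace E := FiniteDimensional.complete ℂ E
  intro x hx
  rw [mem_closure_iff]
  intro N hN hxN
  obtain ⟨W, hW, hxW, m, f, hf, hXW⟩ := hX.2 x (hX.1 hx)
  -- `P r`: some `r` analytic functions vanishing on `X` have independent differentials at a point
  -- of `X` near `x`.
  let P : ℕ → Prop := fun r => ∃ (S : Set E) (G : E → Fin r → ℂ), IsOpen S ∧ S ⊆ N ∩ (W ∩ Ω) ∧
    AnalyticOnNhd ℂ G S ∧ (∀ y ∈ X ∩ S, G y = 0) ∧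
    ∃ a ∈ X ∩ S, Function.Surjective (fderiv ℂ G a)
  obtain ⟨r, ⟨S, G, hS, hSsub, hG, hGX, a, ⟨haX, haS⟩, hsurj⟩, hmax⟩ :
      ∃ r, P r ∧ ¬ P (r + 1) := by
    by_contra! hcon
    have hP0 : P 0 := ⟨N ∩ (W ∩ Ω), fun _ => 0, hN.inter (hW.inter hΩ), subset_rfl,
      fun _ _ => analyticAt_const, fun _ _ => rfl, x, ⟨hx, hxN, hxW, hX.1 hx⟩,
      fun _ => ⟨0, Subsingleton.elim _ _⟩⟩
    have hP : ∀ r, P r := fun r => by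
      induction r with
      | zero => exact hP0
      | succ r ih => exact hcon r ih
    obtain ⟨_, G, _, _, _, _, a, _, hsurj⟩ := hP (Module.finrank ℂ E + 1)
    have := LinearMap.finrank_le_finrank_of_surjective
      (f := (fderiv ℂ G a).toLinearMap) hsurj
    simp at this
  obtain ⟨e, hae, heS, hean, hesan, heG⟩ := exists_chart_of_surjective_fderiv hS hG haS hsurj
  set A := fderiv ℂ G a with hA
  set L : Submodule ℂ E := LinearMap.ker (A : E →ₗ[ℂ] Fin r → ℂ) with hL
  have hXL : ∀ y ∈ e.source, y ∈ X → e y ∈ L := fun y hy hyX => by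
    change A (e y) = 0
    rw [heG y hy]
    exact hGX y ⟨hyX, heS hy⟩
  have hright : ∀ b ∈ e.source, ∀ v, fderiv ℂ e b (fderiv ℂ e.symm (e b) v) = v := by
    intro b hb v
    have h1 : HasFDerivAt e (fderiv ℂ e b) (e.symm (e b)) := by
      rw [e.left_inv hb]; exact (hean b hb).differentiableAt.hasFDerivAt
    have h2 := h1.comp (e b) (hesan _ (e.map_source hb)).differentiableAt.hasFDerivAt
    have h3 : HasFDerivAt (e ∘ e.symm) (ContinuousLinearMap.id ℂ E) (e b) := by
      refine (hasFDerivAt_id (e b)).congr_of_eventuallyEq ?_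
      filter_upwards [e.open_target.mem_nhds (e.map_source hb)] with z hz using e.right_inv hz
    exact DFunLike.congr_fun (h2.unique h3) v
  have hGder : ∀ b ∈ e.source, ∀ u, fderiv ℂ G b u = A (fderiv ℂ e b u) := by
    intro b hb u
    have h1 : HasFDerivAt G (A.comp (fderiv ℂ e b)) b := by
      refine (A.hasFDerivAt.comp b (hean b hb).differentiableAt.hasFDerivAt).congr_of_eventuallyEq ?_
      filter_upwards [e.open_source.mem_nhds hb] with y hy using (heG y hy).symm
    rw [h1.fderiv]; rfl
  -- By maximality of `r`, in the chart the derivatives along `L` of a function that vanishes on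
  -- `X` vanish on `X` again.
  have hstep : ∀ h : E → ℂ, AnalyticOnNhd ℂ h e.target → (∀ b ∈ e.source, b ∈ X → h (e b) = 0) →
      ∀ v ∈ L, ∀ b ∈ e.source, b ∈ X → fderiv ℂ h (e b) v = 0 := by
    intro h hh hhX v hv b hb hbX
    by_contra hne
    apply hmax
    have hhe : AnalyticOnNhd ℂ (h ∘ e) e.source := fun y hy =>
      (hh _ (e.map_source hy)).comp (hean y hy)
    have hGe : AnalyticOnNhd ℂ G e.source := hG.mono heS
    refine ⟨e.source, fun y => Fin.cons (h (e y)) (G y), e.open_source, heS.trans hSsub, ?_,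
      fun y hy => ?_, b, ⟨hbX, hb⟩, ?_⟩
    · intro y hy
      rw [analyticAt_pi_iff]
      intro i
      refine Fin.cases ?_ (fun i => ?_) i
      · exact hhe y hy
      · exact (analyticAt_pi_iff.1 (hGe y hy)) i
    · funext i
      refine Fin.cases ?_ (fun i => ?_) i
      · exact hhX y hy.2 hy.1
      · simpa using congrFun (hGX y ⟨hy.1, heS hy.2⟩) i
    · have hd : HasFDerivAt (fun y => (Fin.cons (h (e y)) (G y) : Fin (r + 1) → ℂ))
          (ContinuousLinearMap.pi (Fin.cons ((fderiv ℂ h (e b)).comp (fderiv ℂ e b))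
            fun i => (ContinuousLinearMap.proj i).comp (fderiv ℂ G b))) b := by
        rw [hasFDerivAt_pi']
        intro i
        refine Fin.cases ?_ (fun i => ?_) i
        · exact (hh _ (e.map_source hb)).differentiableAt.hasFDerivAt.comp b
            (hean b hb).differentiableAt.hasFDerivAt
        · exact (hasFDerivAt_pi'.1 (hGe b hb).differentiableAt.hasFDerivAt) i
      rw [hd.fderiv]
      intro w
      obtain ⟨u₀, hu₀⟩ := hsurj (Fin.tail w)
      set d := fderiv ℂ h (e b) v with hdv
      refine ⟨fderiv ℂ e.symm (e b) (u₀ + ((w 0 - fderiv ℂ h (e b) u₀) / d) • v), ?_⟩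
      funext i
      refine Fin.cases ?_ (fun i => ?_) i
      · simp only [ContinuousLinearMap.coe_pi', Fin.cons_zero, ContinuousLinearMap.comp_apply]
        rw [hright b hb, map_add, map_smul, ← hdv, smul_eq_mul, div_mul_cancel₀ _ hne]
        ring
      · simp only [ContinuousLinearMap.coe_pi', Fin.cons_succ, ContinuousLinearMap.comp_apply]
        rw [hGder b hb, hright b hb, map_add, map_smul, hu₀, show A v = 0 from hv]
        simp [Fin.tail]
  have hiter : ∀ h : E → ℂ, AnalyticOnNhd ℂ h e.target →
      (∀ b ∈ e.source, b ∈ X → h (e b) = 0) → ∀ v ∈ L, ∀ l : ℕ, ∀ b ∈ e.source, b ∈ X →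
        (fun (f : E → ℂ) y => fderiv ℂ f y v)^[l] h (e b) = 0 := by
    intro h hh hhX v hv l
    induction l with
    | zero => exact hhX
    | succ l ih =>
      rw [Function.iterate_succ_apply']
      exact hstep _ (analyticOnNhd_iterate_fderiv_apply hh v l) ih v hv
  obtain ⟨R, hR, hball⟩ := Metric.isOpen_iff.1 e.open_target (e a) (e.map_source hae)
  let e' := e.restrOpen (e.source ∩ e ⁻¹' Metric.ball (e a) R)
    (e.isOpen_inter_preimage Metric.isOpen_ball)
  have hsrc : e'.source = e.source ∩ (e.source ∩ e ⁻¹' Metric.ball (e a) R) := rfl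
  have htgt : e'.target ⊆ e.target := fun z hz => hz.1
  refine ⟨a, (hSsub haS).1, haX, e', L, ?_, fun y hy => hean y hy.1,
    fun z hz => hesan z (htgt hz), fun y hy => ⟨hXL y hy.1, fun hyL => ?_⟩⟩
  · exact ⟨hae, hae, Metric.mem_ball_self hR⟩
  · have hy' : y ∈ N ∩ (W ∩ Ω) := hSsub (heS hy.1)
    have key : y ∈ X ∩ W := by
      rw [hXW]
      refine ⟨⟨hy'.2.2, hy'.2.1⟩, fun j => ?_⟩
      have hfj : AnalyticOnNhd ℂ (f j ∘ e.symm) e.target := fun z hz =>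
        (hf j _ (hSsub (heS (e.map_target hz))).2.1).comp (hesan z hz)
      have hz : (f j ∘ e.symm) (e a + (e y - e a)) = 0 := by
        refine eq_zero_of_iterate_fderiv_apply_eq_zero (hfj.mono hball)
          (mem_ball_iff_norm.1 hy.2.2) fun l => ?_
        refine hiter _ hfj (fun b hb hbX => ?_) _ (L.sub_mem hyL (hXL a hae haX)) l a hae haX
        rw [Function.comp_apply, e.left_inv hb]
        have : b ∈ X ∩ W := ⟨hbX, (hSsub (heS hb)).2.1⟩
        rw [hXW] at this
        exact this.2 j
      rwa [add_sub_cancel, Function.comp_apply, e.left_inv hy.1] at hz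
    exact key.1

end RegularPoints

end AnalyticDouble

/-! ### The identity theorem on the components of the regular locus -/

namespace AnalyticDouble

section IdentityTheorem

variable {E : Type*} [NormedAddCommGroup E] [NormedSpace ℂ E]

/-- A regular point has a connected neighbourhood in `X`, consisting of regular points, on which
the identity theorem holds: it is the preimage of a ball in a linear chart. -/
theorem exists_isPreconnected_nhdsWithin {X : Set E} {x : E} (hx : x ∈ regularLocus X) :
    ∃ T ⊆ regularLocus X, x ∈ T ∧ IsPreconnected T ∧ (∀ z ∈ T, T ∈ 𝓝[X] z) ∧
      ∀ h : E → ℂ, IsHolomorphicOn X h → ∀ y ∈ T, h =ᶠ[𝓝[X] y] 0 → ∀ z ∈ T, h z = 0 := by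
  obtain ⟨hxX, e, L, hxe, hean, hesan, hXL⟩ := hx
  have hexL : e x ∈ L := (hXL x hxe).1 hxX
  obtain ⟨R, hR, hball⟩ := Metric.isOpen_iff.1 e.open_target (e x) (e.map_source hxe)
  let D : Set L := Metric.ball ⟨e x, hexL⟩ R
  have hDt : ∀ w ∈ D, (w : E) ∈ e.target := fun w hw => hball hw
  have hDX : ∀ w ∈ D, e.symm (w : E) ∈ X := fun w hw => by
    rw [hXL _ (e.map_target (hDt w hw)), e.right_inv (hDt w hw)]
    exact w.2
  have hDpre : IsPreconnected D :=
    (convex_ball _ _ : Convex ℝ (Metric.ball (⟨e x, hexL⟩ : L) R)).isPreconnected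
  have hcont : ContinuousOn (fun w : L => e.symm (w : E)) D :=
    e.continuousOn_symm.comp continuous_subtype_val.continuousOn hDt
  have htend : ∀ w ∈ D, Tendsto (fun w : L => e.symm (w : E)) (𝓝 w) (𝓝[X] (e.symm (w : E))) := by
    intro w hw
    have hDn : D ∈ 𝓝 w := Metric.isOpen_ball.mem_nhds hw
    refine tendsto_nhdsWithin_iff.2 ⟨hcont.continuousAt hDn, ?_⟩
    filter_upwards [hDn] with w' hw' using hDX w' hw'
  refine ⟨(fun w : L => e.symm (w : E)) '' D, ?_, ?_, hDpre.image _ hcont, ?_, ?_⟩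
  · rintro _ ⟨w, hw, rfl⟩
    exact ⟨hDX w hw, e, L, e.map_target (hDt w hw), hean, hesan, hXL⟩
  · exact ⟨⟨e x, hexL⟩, Metric.mem_ball_self hR, e.left_inv hxe⟩
  · rintro _ ⟨w, hw, rfl⟩
    have hs : e.source ∩ e ⁻¹' Metric.ball (e x) R ∈ 𝓝 (e.symm (w : E)) := by
      refine (e.isOpen_inter_preimage Metric.isOpen_ball).mem_nhds
        ⟨e.map_target (hDt w hw), ?_⟩
      rw [Set.mem_preimage, e.right_inv (hDt w hw)]
      exact hw
    filter_upwards [mem_nhdsWithin_of_mem_nhds hs, self_mem_nhdsWithin] with y hy hyX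
    exact ⟨⟨e y, (hXL y hy.1).1 hyX⟩, hy.2, e.left_inv hy.1⟩
  · rintro h hh _ ⟨w₀, hw₀, rfl⟩ h0 _ ⟨w₁, hw₁, rfl⟩
    have han : AnalyticOnNhd ℂ (fun w : L => h (e.symm (w : E))) D := by
      intro w hw
      obtain ⟨F, hF, hFh⟩ := hh _ (hDX w hw)
      have h1 : AnalyticAt ℂ (fun w : L => F (e.symm (w : E))) w :=
        hF.comp_of_eq ((hesan _ (hDt w hw)).comp_of_eq (L.subtypeL.analyticAt w) rfl) rfl
      refine h1.congr ?_
      have h2 : h =ᶠ[𝓝[X] (e.symm (w : E))] F := Germ.coe_eq.1 hFh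
      exact ((htend w hw).eventually h2).mono fun _ hy => hy.symm
    exact han.eqOn_zero_of_preconnected_of_eventuallyEq_zero hDpre hw₀
      ((htend w₀ hw₀).eventually h0) hw₁

/-- A holomorphic function that is nonzero somewhere on a connected component of the regular locus
is nonzero on a dense subset of that component. -/
theorem IsHolomorphicOn.subset_closure_ne_zero {X : Set E} {x₀ c : E} {h : E → ℂ}
    (hh : IsHolomorphicOn X h) (hc : c ∈ connectedComponentIn (regularLocus X) x₀) (hne : h c ≠ 0) :
    connectedComponentIn (regularLocus X) x₀ ⊆
      closure {y ∈ connectedComponentIn (regularLocus X) x₀ | h y ≠ 0} := by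
  set C := connectedComponentIn (regularLocus X) x₀ with hC
  have hCreg : C ⊆ regularLocus X := connectedComponentIn_subset _ _
  have hregX : regularLocus X ⊆ X := fun _ hy => hy.1
  intro x hx
  have hiff : (h =ᶠ[𝓝[X] x] 0) ↔ (h =ᶠ[𝓝[X] c] 0) := by
    refine isPreconnected_connectedComponentIn.induction₂
      (fun y z => (h =ᶠ[𝓝[X] y] 0) ↔ (h =ᶠ[𝓝[X] z] 0)) ?_ (fun _ _ _ _ _ _ h1 h2 => h1.trans h2)
      (fun _ _ _ _ h1 => h1.symm) hx hc
    intro y hy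
    obtain ⟨T, -, hyT, -, hTn, hTid⟩ := exists_isPreconnected_nhdsWithin (hCreg hy)
    have : T ∈ 𝓝[C] y := nhdsWithin_mono y (hCreg.trans hregX) (hTn y hyT)
    filter_upwards [this] with z hz
    have hT : ∀ u ∈ T, ∀ v ∈ T, h =ᶠ[𝓝[X] u] 0 → h =ᶠ[𝓝[X] v] 0 := fun u hu v hv h0 =>
      mem_of_superset (hTn v hv) fun w hw => hTid h hh u hu h0 w hw
    exact ⟨hT y hyT z hz, hT z hz y hyT⟩
  have hx0 : ¬ h =ᶠ[𝓝[X] x] 0 := fun h0 =>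
    hne ((hiff.1 h0).eq_of_nhdsWithin (hregX (hCreg hc)))
  obtain ⟨T, hTreg, hxT, hTpre, hTn, -⟩ := exists_isPreconnected_nhdsWithin (hCreg hx)
  have hTC : T ⊆ C := by
    rw [hC, connectedComponentIn_eq hx]
    exact hTpre.subset_connectedComponentIn hxT hTreg
  rw [mem_closure_iff_frequently]
  have hfreq : ∃ᶠ y in 𝓝[X] x, h y ≠ 0 := not_eventually.1 hx0
  exact ((hfreq.and_eventually (hTn x hxT)).filter_mono nhdsWithin_le_nhds).mono
    fun y hy => ⟨hTC hy.2, hy.1⟩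

end IdentityTheorem

end AnalyticDouble

/-! ### Minors and ranks -/

namespace AnalyticDouble

section Minors

/-- If a `k × k` minor of a matrix of generators of `N` is invertible and all `(k + 1) × (k + 1)`
minors vanish, then the coordinates of the elements of `N` are fixed linear combinations of the
`k` coordinates that occur in that minor. -/
theorem exists_coeff_of_isUnit_det {R ι κ : Type*} [CommRing R] {k : ℕ} (g : κ → ι → R)
    (rows : Fin k → ι) (cols : Fin k → κ)
    (hunit : IsUnit (Matrix.det (Matrix.of fun a b => g (cols b) (rows a))))
    (hzero : ∀ (rows' : Fin (k + 1) → ι) (cols' : Fin (k + 1) → κ),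
      Matrix.det (Matrix.of fun a b => g (cols' b) (rows' a)) = 0) :
    ∃ c : ι → Fin k → R, ∀ h ∈ Submodule.span R (Set.range g), ∀ i,
      h i = ∑ a, c i a * h (rows a) := by
  set B : Matrix (Fin k) (Fin k) R := Matrix.of fun a b => g (cols b) (rows a) with hB
  have := B.invertibleOfIsUnitDet hunit
  refine ⟨fun i a => Matrix.vecMul (fun b => g (cols b) i) (⅟B) a, fun h hh i => ?_⟩
  induction hh using Submodule.span_induction with
  | mem v hv =>
    obtain ⟨j, rfl⟩ := hv
    have h0 := hzero (Sum.elim rows (fun _ : Fin 1 => i) ∘ finSumFinEquiv.symm)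
      (Sum.elim cols (fun _ : Fin 1 => j) ∘ finSumFinEquiv.symm)
    have h1 : (Matrix.fromBlocks B (Matrix.of fun a (_ : Fin 1) => g j (rows a))
        (Matrix.of fun (_ : Fin 1) b => g (cols b) i)
        (Matrix.of fun (_ _ : Fin 1) => g j i)).det = 0 := by
      rw [← h0, ← Matrix.det_submatrix_equiv_self finSumFinEquiv.symm]
      congr 1
      ext a b
      simp only [Matrix.submatrix_apply, Matrix.of_apply, Function.comp_apply]
      rcases finSumFinEquiv.symm a with a | a <;> rcases finSumFinEquiv.symm b with b | b <;> rfl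
    -- The Schur complement of `B` in the bordered matrix is a `1 × 1` matrix.
    rw [Matrix.det_fromBlocks₁₁, hunit.mul_right_eq_zero, Matrix.det_fin_one,
      Matrix.sub_apply, sub_eq_zero] at h1
    exact h1
  | zero => simp
  | add v w _ _ hv hw => simp only [Pi.add_apply, hv, hw, mul_add, Finset.sum_add_distrib]
  | smul r v _ hv =>
    simp only [Pi.smul_apply, smul_eq_mul, hv, Finset.mul_sum]
    exact Finset.sum_congr rfl fun a _ => by ring

/-- A `2k × 2k` determinant whose upper half is congruent to its lower half modulo `J` lies in
`J ^ k`. -/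
theorem det_mem_pow_of_sub_mem {S : Type*} [CommRing S] {k : ℕ} (J : Ideal S)
    (N : Matrix (Fin k ⊕ Fin k) (Fin k ⊕ Fin k) S)
    (hN : ∀ a b, N (Sum.inl a) b - N (Sum.inr a) b ∈ J) : N.det ∈ J ^ k := by
  -- Subtract the lower half of the rows from the upper half.
  let T : Matrix (Fin k ⊕ Fin k) (Fin k ⊕ Fin k) S := Matrix.fromBlocks 1 (-1) 0 1
  have hT : T.det = 1 := by simp [T]
  have hTN : ∀ a b, (T * N) (Sum.inl a) b ∈ J := by
    intro a b
    have : (T * N) (Sum.inl a) b = N (Sum.inl a) b - N (Sum.inr a) b := by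
      simp [T, Matrix.mul_apply, Matrix.one_apply, sub_eq_add_neg]
    rw [this]
    exact hN a b
  rw [← one_mul N.det, ← hT, ← Matrix.det_mul, ← Matrix.det_transpose, Matrix.det_apply]
  refine Ideal.sum_mem _ fun σ _ => ?_
  rw [Units.smul_def, zsmul_eq_mul]
  refine Ideal.mul_mem_left _ _ ?_
  rw [Fintype.prod_sum_type]
  refine Ideal.mul_mem_right _ _ ?_
  have := Ideal.prod_mem_prod (s := (Finset.univ : Finset (Fin k))) (I := fun _ => J)
    (x := fun a => (T * N).transpose (σ (Sum.inl a)) (Sum.inl a)) fun a _ => hTN a _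
  simpa using this

/-- If the elements of `W ⊆ S^ι ⊕ S^ι` are determined linearly by `k` coordinates in each half, and
the two halves are congruent modulo `J`, then all `2k × 2k` minors lie in `J ^ k`. -/
theorem minorIdeal_two_mul_le_pow {S ι : Type*} [CommRing S] {k : ℕ} (J : Ideal S)
    (W : Submodule S (ι ⊕ ι → S)) (rows : Fin k → ι) (c₁ c₂ : ι → Fin k → S)
    (h₁ : ∀ w ∈ W, ∀ i, w (Sum.inl i) = ∑ a, c₁ i a * w (Sum.inl (rows a)))
    (h₂ : ∀ w ∈ W, ∀ i, w (Sum.inr i) = ∑ a, c₂ i a * w (Sum.inr (rows a)))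
    (hJ : ∀ w ∈ W, ∀ i, w (Sum.inl i) - w (Sum.inr i) ∈ J) :
    minorIdeal (2 * k) W ≤ J ^ k := by
  refine Ideal.span_le.2 ?_
  rintro _ ⟨rho, cols, hcols, rfl⟩
  let ε : Fin k ⊕ Fin k ≃ Fin (2 * k) := finSumFinEquiv.trans (finCongr (two_mul k).symm)
  let C : ι ⊕ ι → Fin k ⊕ Fin k → S :=
    Sum.elim (fun i => Sum.elim (c₁ i) 0) (fun i => Sum.elim 0 (c₂ i))
  let N : Matrix (Fin k ⊕ Fin k) (Fin (2 * k)) S :=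
    Matrix.of fun a j => cols j (Sum.map rows rows a)
  have hmul : (Matrix.of fun i j => cols j (rho i)) =
      (Matrix.of fun i a => C (rho i) a) * N := by
    ext i j
    rw [Matrix.mul_apply, Fintype.sum_sum_type]
    simp only [Matrix.of_apply, N, C]
    rcases rho i with i | i
    · simpa using h₁ _ (hcols j) i
    · simpa using h₂ _ (hcols j) i
  rw [hmul, ← Matrix.submatrix_id_id (_ * N), ← Matrix.submatrix_mul_equiv _ _ _ ε.symm,
    Matrix.det_mul]
  refine Ideal.mul_mem_left _ _ ?_
  rw [← Matrix.det_submatrix_equiv_self ε]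
  exact det_mem_pow_of_sub_mem J _ fun a b => by simpa [N] using hJ _ (hcols (ε b)) (rows a)

theorem exists_det_ne_zero_of_finrank_eq {K ι κ : Type*} [Field K] [Finite ι] {k : ℕ}
    (v : κ → ι → K) (hk : Module.finrank K (Submodule.span K (Set.range v)) = k) :
    ∃ (rows : Fin k → ι) (cols : Fin k → κ),
      Matrix.det (Matrix.of fun a b => v (cols b) (rows a)) ≠ 0 := by
  have := Fintype.ofFinite ι
  have hbasis := Submodule.exists_fun_fin_finrank_span_eq K (Set.range v)
  rw [hk] at hbasis
  obtain ⟨f, hf, -, hfi⟩ := hbasis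
  choose cols hcols using hf
  let A : Matrix ι (Fin k) K := Matrix.of fun i b => v (cols b) i
  have hA : A.rank = k := by
    have h1 : LinearIndependent K A.col := by
      rw [show A.col = f from funext hcols]
      exact hfi
    have := h1.rank_matrix
    simpa using this
  have hA' : Module.finrank K (Submodule.span K (Set.range A.row)) = k := by
    rw [← A.rank_eq_finrank_span_row, hA]
  have hbasis' := Submodule.exists_fun_fin_finrank_span_eq K (Set.range A.row)
  rw [hA'] at hbasis'
  obtain ⟨f', hf', -, hfi'⟩ := hbasis'
  choose rows hrows using hf'
  refine ⟨rows, cols, ?_⟩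
  have h2 : LinearIndependent K
      (Matrix.of fun a b => v (cols b) (rows a) : Matrix (Fin k) (Fin k) K).row := by
    rwa [show f' = fun a => A.row (rows a) from funext fun a => (hrows a).symm] at hfi'
  exact ((Matrix.isUnit_iff_isUnit_det _).1 (Matrix.linearIndependent_rows_iff_isUnit.1 h2)).ne_zero

theorem det_eq_zero_of_finrank_lt {K ι κ : Type*} [Field K] [Finite ι] {m : ℕ}
    (v : κ → ι → K) (hm : Module.finrank K (Submodule.span K (Set.range v)) < m)
    (rows : Fin m → ι) (cols : Fin m → κ) :
    Matrix.det (Matrix.of fun a b => v (cols b) (rows a)) = 0 := by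
  by_contra hne
  have h1 : LinearIndependent K
      (Matrix.of fun a b => v (cols b) (rows a) : Matrix (Fin m) (Fin m) K).col :=
    Matrix.linearIndependent_cols_of_det_ne_zero hne
  have h2 : LinearIndependent K fun b => v (cols b) :=
    LinearIndependent.of_comp (LinearMap.funLeft K K rows) h1
  have h3 := finrank_span_eq_card h2
  rw [Fintype.card_fin] at h3
  have h4 : Submodule.span K (Set.range fun b => v (cols b)) ≤ Submodule.span K (Set.range v) :=
    Submodule.span_mono (by rintro _ ⟨b, rfl⟩; exact ⟨_, rfl⟩)
  have := Fintype.ofFinite ι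
  have := Submodule.finrank_mono h4
  omega

end Minors

end AnalyticDouble

/-! ### Germs of holomorphic functions -/

namespace AnalyticDouble

section Germs

variable {E : Type*} [NormedAddCommGroup E] [NormedSpace ℂ E] {X : Set E}

/-- The evaluation of germs at a point of `X` as a ring homomorphism. -/
noncomputable def evalGermHom (x : X) : localRing X (x : E) →+* ℂ where
  toFun := evalGerm x
  map_one' := rfl
  map_zero' := rfl
  map_mul' := by
    rintro ⟨_, F, hF, rfl⟩ ⟨_, G, hG, rfl⟩
    rfl
  map_add' := by
    rintro ⟨_, F, hF, rfl⟩ ⟨_, G, hG, rfl⟩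
    rfl

theorem isUnit_of_evalGerm_ne_zero {x : X} {φ : localRing X (x : E)} (h : evalGerm x φ ≠ 0) :
    IsUnit φ := by
  obtain ⟨_, F, hF, rfl⟩ := φ
  have hFx : F x ≠ 0 := h
  refine IsUnit.of_mul_eq_one
    ⟨((F⁻¹ : E → ℂ) : Germ (𝓝[X] (x : E)) ℂ), F⁻¹, hF.inv hFx, rfl⟩ (Subtype.ext ?_)
  refine Germ.coe_eq.2 ?_
  filter_upwards [mem_nhdsWithin_of_mem_nhds (hF.continuousAt.eventually_ne hFx)] with y hy
  exact mul_inv_cancel₀ hy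

theorem IsHolomorphicOn.continuousWithinAt {h : E → ℂ} (hh : IsHolomorphicOn X h) {x : E}
    (hx : x ∈ X) : ContinuousWithinAt h X x := by
  obtain ⟨F, hF, hFh⟩ := hh x hx
  have h1 : h =ᶠ[𝓝[X] x] F := Germ.coe_eq.1 hFh
  exact hF.continuousAt.continuousWithinAt.congr_of_eventuallyEq h1 (h1.eq_of_nhdsWithin hx)

theorem IsHolomorphicOn.eq_zero_of_subset_closure {h : E → ℂ} (hh : IsHolomorphicOn X h)
    {D : Set E} (hDX : D ⊆ X) (hD : X ⊆ closure D) (h0 : ∀ y ∈ D, h y = 0) {x : E} (hx : x ∈ X) :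
    h x = 0 := by
  have h1 := (hh.continuousWithinAt hx).mono hDX
  have : (𝓝[D] x).NeBot := mem_closure_iff_nhdsWithin_neBot.1 (hD hx)
  have h2 : Tendsto h (𝓝[D] x) (𝓝 0) :=
    tendsto_const_nhds.congr' (eventually_nhdsWithin_of_forall fun y hy => (h0 y hy).symm)
  exact tendsto_nhds_unique h1 h2

theorem coe_det_germAt {ι κ : Type*} {m : ℕ} {s : κ → ι → E → ℂ}
    (hs : ∀ j i, IsHolomorphicOn X (s j i)) (rows : Fin m → ι) (cols : Fin m → κ) (x : X) :
    ((Matrix.det (Matrix.of fun a b => germAt (hs (cols b) (rows a)) x) : localRing X (x : E)) :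
      Germ (𝓝[X] (x : E)) ℂ) =
      ((fun y => Matrix.det (Matrix.of fun a b => s (cols b) (rows a) y) : E → ℂ) :
        Germ (𝓝[X] (x : E)) ℂ) := by
  have h1 : (fun y => Matrix.det (Matrix.of fun a b => s (cols b) (rows a) y)) =
      Matrix.det (Matrix.of fun a b => s (cols b) (rows a) : Matrix (Fin m) (Fin m) (E → ℂ)) := by
    funext y
    exact ((Pi.evalRingHom (fun _ : E => ℂ) y).map_det _).symm
  rw [h1]
  have h2 := (Germ.coeRingHom (R := ℂ) (𝓝[X] (x : E))).map_det
    (Matrix.of fun a b => s (cols b) (rows a))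
  have h3 := (localRing X (x : E)).subtype.map_det
    (Matrix.of fun a b => germAt (hs (cols b) (rows a)) x)
  exact h3.trans h2.symm

theorem isHolomorphicOn_det {ι κ : Type*} {m : ℕ} {s : κ → ι → E → ℂ}
    (hs : ∀ j i, IsHolomorphicOn X (s j i)) (rows : Fin m → ι) (cols : Fin m → κ) :
    IsHolomorphicOn X fun y => Matrix.det (Matrix.of fun a b => s (cols b) (rows a) y) :=
  fun x hx => by
    rw [← coe_det_germAt hs rows cols ⟨x, hx⟩]
    exact Subtype.property _

/-- The common zero set of finitely many holomorphic functions on `X` is analytic in `X`. -/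
theorem isAnalyticSubset_zeros {κ : Type*} [Finite κ] {h : κ → E → ℂ}
    (hh : ∀ j, IsHolomorphicOn X (h j)) : IsAnalyticSubset X {y ∈ X | ∀ j, h j y = 0} := by
  refine ⟨fun _ hy => hy.1, fun x hx => ?_⟩
  choose F hF hFh using fun j => hh j x hx
  have e1 : ∀ᶠ y in 𝓝 x, ∀ j, AnalyticAt ℂ (F j) y :=
    eventually_all.2 fun j => (hF j).eventually_analyticAt
  have e2 : ∀ᶠ y in 𝓝 x, y ∈ X → ∀ j, h j y = F j y := by
    rw [← eventually_nhdsWithin_iff]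
    exact eventually_all.2 fun j => Germ.coe_eq.1 (hFh j)
  obtain ⟨W, hW, hWo, hxW⟩ := eventually_nhds_iff.1 (e1.and e2)
  obtain ⟨m, ⟨ε⟩⟩ := Finite.exists_equiv_fin κ
  refine ⟨W, hWo, hxW, m, fun j => F (ε.symm j), fun j y hy => (hW y hy).1 _, ?_⟩
  ext y
  constructor
  · rintro ⟨⟨hyX, hy0⟩, hyW⟩
    exact ⟨⟨hyX, hyW⟩, fun j => ((hW y hyW).2 hyX _).symm.trans (hy0 _)⟩
  · rintro ⟨⟨hyX, hyW⟩, hy0⟩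
    refine ⟨⟨hyX, fun j => ?_⟩, hyW⟩
    rw [(hW y hyW).2 hyX]
    simpa using hy0 (ε j)

theorem IsAnalyticSubset.mono_inter {Y A V : Set E} (hA : IsAnalyticSubset Y A) (hV : V ⊆ Y) :
    IsAnalyticSubset V (V ∩ A) := by
  refine ⟨Set.inter_subset_left, fun x hx => ?_⟩
  obtain ⟨W, hW, hxW, m, f, hf, hAW⟩ := hA.2 x (hV hx)
  refine ⟨W, hW, hxW, m, f, hf, ?_⟩
  rw [Set.inter_assoc, hAW]
  ext y
  exact ⟨fun h => ⟨⟨h.1, h.2.1.2⟩, h.2.2⟩, fun h => ⟨h.1.1, ⟨hV h.1.1, h.1.2⟩, h.2⟩⟩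

end Germs

section RankAndDiagonal

variable {n p : ℕ} {X : Set (Fin n → ℂ)}

theorem rankAt_span_germAt {r : ℕ} {s : Fin r → Fin p → (Fin n → ℂ) → ℂ}
    (hs : ∀ j i, IsHolomorphicOn X (s j i)) (x : X) :
    rankAt x (Submodule.span _ (Set.range fun j => fun i => germAt (hs j i) x)) =
      Module.finrank ℂ (Submodule.span ℂ (Set.range fun j => fun i => s j i x)) := by
  unfold rankAt
  suffices hspan : Submodule.span ℂ ((fun h : Fin p → localRing X (x : Fin n → ℂ) =>
      fun i => evalGerm x (h i)) '' (Submodule.span (localRing X (x : Fin n → ℂ))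
        (Set.range fun j => fun i => germAt (hs j i) x) :
          Set (Fin p → localRing X (x : Fin n → ℂ)))) =
      Submodule.span ℂ (Set.range fun j => fun i => s j i x) by rw [hspan]
  apply le_antisymm
  · refine Submodule.span_le.2 ?_
    rintro _ ⟨h, hh, rfl⟩
    refine Submodule.span_induction (p := fun h _ => (fun i => evalGerm x (h i)) ∈
      Submodule.span ℂ (Set.range fun j => fun i => s j i x)) ?_ ?_ ?_ ?_ hh
    · rintro _ ⟨j, rfl⟩
      exact Submodule.subset_span ⟨j, rfl⟩
    · exact Submodule.zero_mem _
    · intro v w _ _ hv hw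
      have h1 := Submodule.add_mem _ hv hw
      convert h1 using 1
      funext i
      exact (evalGermHom x).map_add (v i) (w i)
    · intro a v _ hv
      have h1 := Submodule.smul_mem _ (evalGerm x a) hv
      convert h1 using 1
      funext i
      exact (evalGermHom x).map_mul a (v i)
  · refine Submodule.span_mono ?_
    rintro _ ⟨j, rfl⟩
    exact ⟨_, Submodule.subset_span ⟨j, rfl⟩, rfl⟩

/-- Hadamard's lemma for germs: `φ ∘ π₁ - φ ∘ π₂` lies in the ideal of the diagonal. -/
theorem pullFst_sub_pullSnd_mem (x : Fin n → ℂ) (φ : localRing X x) :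
    pullFst X x x φ - pullSnd X x x φ ∈ diagonalIdeal X x := by
  obtain ⟨_, F, hF, rfl⟩ := φ
  obtain ⟨G, hG, hFG⟩ := hF.exists_sub_eq_sum
  let γ : Fin n → localRing (X ×ˢ X) (x, x) := fun i => ⟨(G i : Germ _ ℂ), G i, hG i, rfl⟩
  have key : pullFst X x x ⟨_, F, hF, rfl⟩ - pullSnd X x x ⟨_, F, hF, rfl⟩ =
      ∑ i, (pullFst X x x (coordGerm X x i) - pullSnd X x x (coordGerm X x i)) * γ i := by
    apply Subtype.ext
    have h1 := map_sum (localRing (X ×ˢ X) (x, x)).subtype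
      (fun i => (pullFst X x x (coordGerm X x i) - pullSnd X x x (coordGerm X x i)) * γ i)
      Finset.univ
    have h2 := map_sum (Germ.coeRingHom (R := ℂ) (𝓝[X ×ˢ X] (x, x)))
      (fun i (q : (Fin n → ℂ) × (Fin n → ℂ)) => (q.1 i - q.2 i) * G i q) Finset.univ
    refine Eq.trans ?_ (h2.trans h1.symm)
    refine Germ.coe_eq.2 ?_
    filter_upwards [mem_nhdsWithin_of_mem_nhds hFG] with q hq
    rw [Finset.sum_apply]
    exact hq
  rw [key]
  exact Ideal.sum_mem _ fun i _ => Ideal.mul_mem_right _ _ (Ideal.subset_span ⟨i, rfl⟩)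

theorem diagonalIdeal_le_minorIdeal_doubleIdeal_top (x : Fin n → ℂ) :
    diagonalIdeal X x ≤ minorIdeal 2 (doubleIdeal X x ⊤) := by
  refine Ideal.span_le.2 ?_
  rintro _ ⟨i, rfl⟩
  have hmem : ∀ φ : localRing X x, ![pullFst X x x φ, pullSnd X x x φ] ∈ doubleIdeal X x ⊤ :=
    fun φ => Submodule.subset_span ⟨φ, trivial, rfl⟩
  refine Ideal.subset_span ⟨![1, 0], ![![pullFst X x x 1, pullSnd X x x 1],
    ![pullFst X x x (coordGerm X x i), pullSnd X x x (coordGerm X x i)]], fun j => ?_, ?_⟩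
  · fin_cases j
    · exact hmem 1
    · exact hmem _
  · simp [Matrix.det_fin_two]

/-- Where some `k × k` minor of a matrix of generators is invertible and all larger minors vanish,
the `2k × 2k` minors of the double lie in the `k`-th power of the ideal of the diagonal. -/
theorem minorIdeal_doubleModule_le_pow {κ : Type*} {k : ℕ} (x : Fin n → ℂ)
    (g : κ → Fin p → localRing X x) (rows : Fin k → Fin p) (cols : Fin k → κ)
    (hunit : IsUnit (Matrix.det (Matrix.of fun a b => g (cols b) (rows a))))
    (hzero : ∀ (rows' : Fin (k + 1) → Fin p) (cols' : Fin (k + 1) → κ),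
      Matrix.det (Matrix.of fun a b => g (cols' b) (rows' a)) = 0) :
    minorIdeal (2 * k) (doubleModule X x (Submodule.span _ (Set.range g))) ≤
      diagonalIdeal X x ^ k := by
  obtain ⟨c, hc⟩ := exists_coeff_of_isUnit_det g rows cols hunit hzero
  refine minorIdeal_two_mul_le_pow (diagonalIdeal X x) _ rows
    (fun i a => pullFst X x x (c i a)) (fun i a => pullSnd X x x (c i a)) ?_ ?_ ?_
  · intro w hw i
    induction hw using Submodule.span_induction with
    | mem v hv =>
      obtain ⟨h, hh, rfl⟩ := hv
      have := congrArg (pullFst X x x) (hc h hh i)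
      simpa [double] using this
    | zero => simp
    | add v w _ _ hv hw => simp only [Pi.add_apply, hv, hw, mul_add, Finset.sum_add_distrib]
    | smul r v _ hv =>
      simp only [Pi.smul_apply, smul_eq_mul, hv, Finset.mul_sum]
      exact Finset.sum_congr rfl fun a _ => by ring
  · intro w hw i
    induction hw using Submodule.span_induction with
    | mem v hv =>
      obtain ⟨h, hh, rfl⟩ := hv
      have := congrArg (pullSnd X x x) (hc h hh i)
      simpa [double] using this
    | zero => simp
    | add v w _ _ hv hw => simp only [Pi.add_apply, hv, hw, mul_add, Finset.sum_add_distrib]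
    | smul r v _ hv =>
      simp only [Pi.smul_apply, smul_eq_mul, hv, Finset.mul_sum]
      exact Finset.sum_congr rfl fun a _ => by ring
  · intro w hw i
    induction hw using Submodule.span_induction with
    | mem v hv =>
      obtain ⟨h, hh, rfl⟩ := hv
      exact pullFst_sub_pullSnd_mem x (h i)
    | zero => simp
    | add v w _ _ hv hw =>
      simp only [Pi.add_apply, add_sub_add_comm]
      exact Ideal.add_mem _ hv hw
    | smul r v _ hv =>
      simp only [Pi.smul_apply, smul_eq_mul, ← mul_sub]
      exact Ideal.mul_mem_left _ _ hv

end RankAndDiagonal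

end AnalyticDouble

/-! ### The locus of maximal rank -/

theorem lemmaL4p23 {n p k : ℕ} (hk : 1 ≤ k)
    (Ω X : Set (Fin n → ℂ)) (hΩ : IsOpen Ω) (hX : IsAnalyticSubset Ω X)
    (M : ∀ x : X, Submodule (localRing X (x : Fin n → ℂ)) (Fin p → localRing X (x : Fin n → ℂ)))
    (hM : IsGloballyGenerated X M)
    (hrank : ∀ V : Set (Fin n → ℂ), IsComponent X V → HasGenericRank X M V k) :
    ∃ U : Set (Fin n → ℂ), IsDenseZariskiOpenIn X U ∧
      (∀ V : Set (Fin n → ℂ), IsComponent X V → IsDenseZariskiOpenIn V (U ∩ V)) ∧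
      (∀ x : X, (x : Fin n → ℂ) ∈ U → minorIdeal k (M x) = ⊤) ∧
      (∀ x : X, (x : Fin n → ℂ) ∈ U →
        minorIdeal (2 * k) (doubleModule X (x : Fin n → ℂ) (M x)) ≤
          diagonalIdeal X (x : Fin n → ℂ) ^ (k - 1) *
            minorIdeal 2 (doubleIdeal X (x : Fin n → ℂ) (minorIdeal k (M x)))) := by
  obtain ⟨r, s, hs, hMs⟩ := hM
  have hregX : regularLocus X ⊆ X := fun _ hy => hy.1
  have hdense : X ⊆ closure (regularLocus X) := hX.subset_closure_regularLocus hΩ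
  have hrankAt : ∀ x : X, rankAt x (M x) =
      Module.finrank ℂ (Submodule.span ℂ (Set.range fun j => fun i => s j i x)) := fun x => by
    rw [hMs x, rankAt_span_germAt hs x]
  -- The `m × m` minors of the matrix of generators, as functions on `X`.
  let μ : ∀ m : ℕ, (Fin m → Fin p) × (Fin m → Fin r) → (Fin n → ℂ) → ℂ := fun m q y =>
    Matrix.det (Matrix.of fun a b => s (q.2 b) (q.1 a) y)
  have hμ : ∀ m q, IsHolomorphicOn X (μ m q) := fun m q => isHolomorphicOn_det hs q.1 q.2
  have hbig : ∀ q, ∀ y ∈ X, μ (k + 1) q y = 0 := by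
    intro q y hy
    refine (hμ (k + 1) q).eq_zero_of_subset_closure hregX hdense (fun z hz => ?_) hy
    have hzV : z ∈ X ∩ closure (connectedComponentIn (regularLocus X) z) :=
      ⟨hregX hz, subset_closure (mem_connectedComponentIn hz)⟩
    have hle : rankAt ⟨z, hregX hz⟩ (M ⟨z, hregX hz⟩) ≤ k :=
      (hrank _ ⟨z, hz, rfl⟩).2 ⟨⟨z, hregX hz⟩, hzV, rfl⟩
    rw [hrankAt] at hle
    exact det_eq_zero_of_finrank_lt (fun j i => s j i z) (Nat.lt_succ_of_le hle) q.1 q.2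
  let A : Set (Fin n → ℂ) := {y ∈ X | ∀ q, μ k q y = 0}
  have hA : IsAnalyticSubset X A := isAnalyticSubset_zeros (hμ k)
  let U : Set (Fin n → ℂ) := X \ A
  have hUmem : ∀ y ∈ X, ∀ q, μ k q y ≠ 0 → y ∈ U := fun y hy q hq => ⟨hy, fun h => hq (h.2 q)⟩
  have hcomp : ∀ x₀ ∈ regularLocus X, connectedComponentIn (regularLocus X) x₀ ⊆
      closure (U ∩ connectedComponentIn (regularLocus X) x₀) := by
    intro x₀ hx₀
    set C := connectedComponentIn (regularLocus X) x₀ with hC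
    have hCX : C ⊆ X := (connectedComponentIn_subset _ _).trans hregX
    obtain ⟨⟨v, hvX⟩, ⟨-, hvC⟩, hvk⟩ := (hrank _ ⟨x₀, hx₀, rfl⟩).1
    rw [hrankAt] at hvk
    obtain ⟨rows, cols, hdet⟩ := exists_det_ne_zero_of_finrank_eq _ hvk
    -- The minor is nonzero at a point of the closure of `C`, hence also at a point of `C`.
    obtain ⟨c, hcC, hc⟩ : ∃ c ∈ C, μ k (rows, cols) c ≠ 0 := by
      by_contra! hcon
      have h1 := ((hμ k (rows, cols)).continuousWithinAt hvX).mono hCX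
      have : (𝓝[C] v).NeBot := mem_closure_iff_nhdsWithin_neBot.1 hvC
      exact hdet (tendsto_nhds_unique h1 (tendsto_const_nhds.congr'
        (eventually_nhdsWithin_of_forall fun y hy => (hcon y hy).symm)))
    refine ((hμ k (rows, cols)).subset_closure_ne_zero hcC hc).trans (closure_mono ?_)
    rintro y ⟨hyC, hy⟩
    exact ⟨hUmem y (hCX hyC) _ hy, hyC⟩
  have hlocal : ∀ x : X, (x : Fin n → ℂ) ∈ U → ∃ (rows : Fin k → Fin p) (cols : Fin k → Fin r),
      IsUnit (Matrix.det (Matrix.of fun a b => germAt (hs (cols b) (rows a)) x)) := by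
    rintro x ⟨hxX, hxA⟩
    obtain ⟨q, hq⟩ : ∃ q, μ k q x ≠ 0 := by
      by_contra! hcon
      exact hxA ⟨hxX, hcon⟩
    refine ⟨q.1, q.2, isUnit_of_evalGerm_ne_zero ?_⟩
    have h1 := (evalGermHom x).map_det (Matrix.of fun a b => germAt (hs (q.2 b) (q.1 a)) x)
    exact fun h0 => hq (h1.symm.trans h0)
  have hone : ∀ x : X, (x : Fin n → ℂ) ∈ U → minorIdeal k (M x) = ⊤ := by
    intro x hx
    obtain ⟨rows, cols, hunit⟩ := hlocal x hx
    refine Ideal.eq_top_of_isUnit_mem _ ?_ hunit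
    rw [hMs x, minorIdeal_span]
    exact Ideal.subset_span ⟨rows, cols, rfl⟩
  refine ⟨U, ⟨⟨Set.sdiff_subset, ?_⟩, ?_⟩, ?_, hone, ?_⟩
  · rwa [Set.sdiff_sdiff_cancel_left hA.1]
  · refine hdense.trans (closure_minimal ?_ isClosed_closure)
    intro z hz
    exact closure_mono Set.inter_subset_left (hcomp z hz (mem_connectedComponentIn hz))
  · rintro _ ⟨x₀, hx₀, rfl⟩
    have hCX : connectedComponentIn (regularLocus X) x₀ ⊆ X :=
      (connectedComponentIn_subset _ _).trans hregX
    set V := X ∩ closure (connectedComponentIn (regularLocus X) x₀) with hV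
    refine ⟨⟨Set.inter_subset_right, ?_⟩, ?_⟩
    · have hVA : V \ (U ∩ V) = V ∩ A := by
        ext y
        constructor
        · rintro ⟨hyV, hy⟩
          exact ⟨hyV, by_contra fun hyA => hy ⟨⟨hyV.1, hyA⟩, hyV⟩⟩
        · rintro ⟨hyV, hyA⟩
          exact ⟨hyV, fun hy => hy.1.2 hyA⟩
      rw [hVA]
      exact hA.mono_inter Set.inter_subset_left
    · refine Set.inter_subset_right.trans (closure_minimal ?_ isClosed_closure)
      refine (hcomp x₀ hx₀).trans (closure_mono ?_)
      exact Set.inter_subset_inter_right _ (Set.subset_inter hCX subset_closure)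
  · intro x hx
    obtain ⟨rows, cols, hunit⟩ := hlocal x hx
    have hzero : ∀ (rows' : Fin (k + 1) → Fin p) (cols' : Fin (k + 1) → Fin r),
        Matrix.det (Matrix.of fun a b => germAt (hs (cols' b) (rows' a)) x) = 0 := by
      intro rows' cols'
      apply Subtype.ext
      rw [coe_det_germAt hs rows' cols' x]
      exact Germ.coe_eq.2 (eventually_nhdsWithin_of_forall fun y hy => hbig (rows', cols') y hy)
    rw [hone x hx]
    calc minorIdeal (2 * k) (doubleModule X (x : Fin n → ℂ) (M x))
        ≤ diagonalIdeal X (x : Fin n → ℂ) ^ k := by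
          rw [hMs x]
          exact minorIdeal_doubleModule_le_pow (x : Fin n → ℂ)
            (fun j i => germAt (hs j i) x) rows cols hunit hzero
      _ = diagonalIdeal X (x : Fin n → ℂ) ^ (k - 1) * diagonalIdeal X (x : Fin n → ℂ) := by
          rw [← pow_succ, Nat.sub_add_cancel hk]
      _ ≤ _ := Ideal.mul_mono_right (diagonalIdeal_le_minorIdeal_doubleIdeal_top _)
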